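/- For a positive integer $r$ and a finite graph $H$, let $\hat R_r(H)$ denote the smallest number of edges in a finite graph $G$ such that every $r$-coloring of the edges of $G$ contains a monochromatic copy of $H$. For a tree $T$ with bipartition $\{V_1,V_2\}$ put $n_i=|V_i|$, $\Delta_i=\max\{d(v):v\in V_i\}$ and $\beta(T)=n_1\Delta_1+n_2\Delta_2$, and for $0<\alpha\le 1$ call $T$ $\alpha$-full if $\Delta_1\ge\alpha n_2$ or $\Delta_2\ge\alpha n_1$. (a) There are an absolute constant $c>0$ and numbers $n_0(r)$ depending only on $r$, and for every $0<\alpha\le 1$ there is a constant $C=C(\alpha)>0$, such that for every integer $r\ge 16$, every finite $\alpha$-full tree $T$ that is not a star satisfies $\hat R_r(T)\le C\,r^2\beta(T)$ and, if $T$ has at least $n_0(r)$ vertices, also $\hat R_r(T)\ge c\,r^2\beta(T)$. In particular, if $\mathcal T$ is an infinite family of pairwise non-isomorphic non-star $\alpha$-full trees and $r\ge 16$, then $\hat R_r(T)=\Theta(r^2\beta(T))$ as $|V(T)|\to\infty$, $T\in\mathcal T$, with implied constants that do not depend on $r$. (b) Every finite tree of radius $2$ is $1$-full and not a star, and for every $0<\alpha\le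 1$ every tree on $n$ vertices with maximum degree at least $\alpha n$ is $\alpha$-full. -/

import Mathlib

universe u

namespace SizeRamsey

open SimpleGraph

/-- `G` arrows `H` in `r` colours: every colouring of the edges of `G` with `r` colours contains
a monochromatic copy of `H` (a not necessarily induced subgraph isomorphic to `H`). -/
def Arrows {W : Type*} {V : Type*} (r : ℕ) (G : SimpleGraph W) (H : SimpleGraph V) : Prop :=
  ∀ χ : G.EdgeLabeling (Fin r), ∃ k : Fin r, H.IsContained (χ.labelGraph k)

/-- The set of all numbers of edges of finite graphs `G` that arrow `H` in `r` colours. -/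
def arrowingSizes {V : Type*} (r : ℕ) (H : SimpleGraph V) : Set ℕ :=
  {m | ∃ (N : ℕ) (G : SimpleGraph (Fin N)), Arrows r G H ∧ G.edgeSet.ncard = m}

/-- The `r`-colour size-Ramsey number of `H`: the least number of edges in a finite graph that
arrows `H` in `r` colours. -/
noncomputable def sizeRamsey {V : Type*} (r : ℕ) (H : SimpleGraph V) : ℕ :=
  sInf (arrowingSizes r H)

/-- A star: some centre is adjacent to all other vertices, and there are no other edges. -/
def IsStar {V : Type*} (G : SimpleGraph V) : Prop :=
  ∃ c : V, G = starGraph c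

/-- `V₁`, `V₂` is a bipartition of (the whole vertex set of) `G`. For a connected graph it is
unique up to swapping the two parts. -/
structure IsBipartition {V : Type*} (G : SimpleGraph V) (V₁ V₂ : Finset V) : Prop where
  isBipartiteWith : G.IsBipartiteWith (V₁ : Set V) (V₂ : Set V)
  cover : ∀ v : V, v ∈ V₁ ∨ v ∈ V₂

section Degrees

variable {V : Type*} [Fintype V] (G : SimpleGraph V) [DecidableRel G.Adj]

/-- `Δ(S)`, the maximum degree in `G` of a vertex of `S` (and `0` if `S` is empty). -/
def maxDegreeOn (S : Finset V) : ℕ :=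
  S.sup fun v => G.degree v

/-- `β(G) = n₁ Δ₁ + n₂ Δ₂`, for the bipartition `V₁`, `V₂` of `G`. -/
def beta (V₁ V₂ : Finset V) : ℕ :=
  V₁.card * maxDegreeOn G V₁ + V₂.card * maxDegreeOn G V₂

/-- `G`, with bipartition `V₁`, `V₂`, is `α`-full: `Δ₁ ≥ α n₂` or `Δ₂ ≥ α n₁`. -/
def IsFull (α : ℝ) (V₁ V₂ : Finset V) : Prop :=
  α * (V₂.card : ℝ) ≤ (maxDegreeOn G V₁ : ℝ) ∨ α * (V₁.card : ℝ) ≤ (maxDegreeOn G V₂ : ℝ)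

end Degrees

end SizeRamsey

namespace SizeRamsey

open SimpleGraph Finset

/-! ### Colourings without monochromatic copies, and bipartitions of connected graphs -/

section Generic

variable {V W : Type*}

/-! Upper bound. In the biclique with parts of size 4r·n₁ and 4r·n₂ some colour has at least the
average number of edges. Deleting vertices of low degree leaves a nonempty bipartite graph with
large degrees on both sides (`exists_large_degrees`), into which `T` embeds leaf by leaf
(`exists_tree_embedding`). There are 16r²n₁n₂ edges, and fullness gives α·n₁n₂ ≤ β.

Lower bound. Every `G` with fewer than k²n₁Δ₁/65536 edges has a good colouring with 8k colours,
provided 8k ≤ |V(T)| (`avoids_of_few_edges`); this is used for both parts of the bipartition with k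
= ⌊r/8⌋. Let X be the set of vertices of degree above kΔ₁/256, so that |X| < k·n₁/128, and Y the
rest. Inside Y, a greedy colouring keeps all colour degrees below Δ₁. Inside X, edges are coloured
by slopes in an affine plane, so a monochromatic component lies over one line and is too small for
`T`. Between X and Y, every x gets three random labels out of k, every y selects one label of each
neighbour x, no label Δ₁ times or more, and each label class is cut into blocks of fewer than n₁
vertices. A monochromatic copy of `T` would put V₁ into one block, or a vertex of degree Δ₁ into Y;
both are impossible. By Hall's theorem and a union bound (`card_not_selectable_mul_le`) a given y
cannot select with probability at most 1/k². Hence for some labels the exceptional set B has fewer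
than n₁ vertices, and the edges between X and B can be coloured by blocks of X alone. -/

/-- There is a colouring of the edges of `G` with the colours `0, …, a - 1` that has no
monochromatic copy of `H`. -/
def Avoids (a : ℕ) (G : SimpleGraph W) (H : SimpleGraph V) : Prop :=
  ∃ c : W → W → ℕ, (∀ u v, G.Adj u v → c u v = c v u ∧ c u v < a) ∧
    ∀ (j : ℕ) (f : V → W), Function.Injective f →
      ¬ ∀ u v, H.Adj u v → G.Adj (f u) (f v) ∧ c (f u) (f v) = j

lemma Avoids.not_arrows {r : ℕ} {G : SimpleGraph W} {H : SimpleGraph V} (h : Avoids r G H) :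
    ¬ Arrows r G H := by
  obtain ⟨c, hc, hH⟩ := h
  intro hA
  obtain ⟨k, ⟨f⟩⟩ := hA (EdgeLabeling.mk (fun x y h => (⟨c x y, (hc x y h).2⟩ : Fin r))
    (fun x y h => Fin.ext (hc x y h).1.symm))
  refine hH k f f.injective fun u v huv => ?_
  obtain ⟨h1, h2⟩ := (EdgeLabeling.labelGraph_adj _ _).1 (f.toHom.map_adj huv)
  exact ⟨h1, congrArg Fin.val h2⟩

lemma Avoids.mono {a b : ℕ} {G G' : SimpleGraph W} {H : SimpleGraph V} (h : Avoids a G' H)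
    (hab : a ≤ b) (hG : G ≤ G') : Avoids b G H := by
  obtain ⟨c, hc, hH⟩ := h
  exact ⟨c, fun u v huv => ⟨(hc u v (hG huv)).1, (hc u v (hG huv)).2.trans_le hab⟩,
    fun j f hf h => hH j f hf fun u v huv => ⟨hG (h u v huv).1, (h u v huv).2⟩⟩

/-- Disjoint palettes; an edge of both graphs follows the first colouring. This lets the edges be
treated in separate groups. -/
lemma Avoids.sup {a b : ℕ} {G₁ G₂ : SimpleGraph W} {H : SimpleGraph V} (h₁ : Avoids a G₁ H)
    (h₂ : Avoids b G₂ H) : Avoids (a + b) (G₁ ⊔ G₂) H := by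
  classical
  obtain ⟨c₁, hc₁, hH₁⟩ := h₁
  obtain ⟨c₂, hc₂, hH₂⟩ := h₂
  refine ⟨fun u v => if G₁.Adj u v then c₁ u v else a + c₂ u v, fun u v huv => ?_,
    fun j f hf h => ?_⟩
  · by_cases h1 : G₁.Adj u v
    · have := hc₁ u v h1
      simp only [h1, h1.symm, if_true]
      exact ⟨this.1, by omega⟩
    · have h2 : G₂.Adj u v := by simpa [h1] using huv
      have := hc₂ u v h2
      have h1' : ¬ G₁.Adj v u := fun h => h1 h.symm
      simp only [h1, h1', if_false]
      omega
  · by_cases hj : j < a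
    · refine hH₁ j f hf fun u v huv => ?_
      obtain ⟨-, h2⟩ := h u v huv
      by_cases h1 : G₁.Adj (f u) (f v)
      · exact ⟨h1, by simpa [h1] using h2⟩
      · simp only [h1, if_false] at h2
        omega
    · refine hH₂ (j - a) f hf fun u v huv => ?_
      obtain ⟨h3, h2⟩ := h u v huv
      by_cases h1 : G₁.Adj (f u) (f v)
      · simp only [h1, if_true] at h2
        have := (hc₁ _ _ h1).2
        omega
      · simp only [h1, if_false] at h2
        exact ⟨by simpa [h1] using h3, by omega⟩

/-- A colouring with values in a finite type that has no monochromatic copy of `H`. -/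
lemma avoids_of_coloring {κ : Type*} [Fintype κ] {a : ℕ} {G : SimpleGraph W} {H : SimpleGraph V}
    (c : W → W → κ) (hκ : Fintype.card κ ≤ a) (hc : ∀ u v, G.Adj u v → c u v = c v u)
    (hH : ∀ (j : κ) (f : V → W), Function.Injective f →
      ¬ ∀ u v, H.Adj u v → G.Adj (f u) (f v) ∧ c (f u) (f v) = j)
    (hne : ∃ u v, H.Adj u v) : Avoids a G H := by
  refine ⟨fun u v => Fintype.equivFin κ (c u v), fun u v huv => ⟨by simp only [hc u v huv],
    (Fin.is_lt _).trans_le hκ⟩, fun j f hf h => ?_⟩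
  -- One edge of `H` is needed to know that the number `j` comes from a colour in `κ`.
  obtain ⟨u₀, v₀, h₀⟩ := hne
  refine hH (c (f u₀) (f v₀)) f hf fun u v huv => ⟨(h u v huv).1, ?_⟩
  have := (h u v huv).2.trans (h u₀ v₀ h₀).2.symm
  exact (Fintype.equivFin κ).injective (Fin.ext this)

lemma eq_of_connected {α : Type*} {G : SimpleGraph V} (hG : G.Preconnected) (g : V → α)
    (hg : ∀ u v, G.Adj u v → g u = g v) (u v : V) : g u = g v := by
  obtain ⟨p⟩ := hG u v
  induction p with
  | nil => rfl
  | cons h _ ih => exact (hg _ _ h).trans ih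

lemma IsBipartition.symm {G : SimpleGraph V} {V₁ V₂ : Finset V} (h : IsBipartition G V₁ V₂) :
    IsBipartition G V₂ V₁ :=
  ⟨h.isBipartiteWith.symm, fun v => (h.cover v).symm⟩

lemma IsBipartition.not_mem {G : SimpleGraph V} {V₁ V₂ : Finset V} (h : IsBipartition G V₁ V₂)
    {v : V} (hv : v ∈ V₁) : v ∉ V₂ := by
  have := h.isBipartiteWith.disjoint
  rw [Finset.disjoint_coe] at this
  exact Finset.disjoint_left.1 this hv

lemma IsBipartition.mem_right {G : SimpleGraph V} {V₁ V₂ : Finset V} (h : IsBipartition G V₁ V₂)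
    {u v : V} (huv : G.Adj u v) (hu : u ∈ V₁) : v ∈ V₂ := by
  rcases h.isBipartiteWith.mem_of_adj huv with h' | h'
  · exact h'.2
  · exact absurd h'.1 (h.not_mem hu)

/-- A map from a connected bipartite graph that sends edges across `X`, `Y` maps the parts of the
bipartition to `X` and `Y`, in some order. -/
lemma IsBipartition.sides {G : SimpleGraph V} {V₁ V₂ : Finset V} (h : IsBipartition G V₁ V₂)
    [Nontrivial V] (hG : G.Connected) (f : V → W) {X Y : Set W} (hXY : Disjoint X Y)
    (hf : ∀ u v, G.Adj u v → (f u ∈ X ∧ f v ∈ Y) ∨ (f u ∈ Y ∧ f v ∈ X)) :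
    ((∀ v ∈ V₁, f v ∈ X) ∧ ∀ v ∈ V₂, f v ∈ Y) ∨ ((∀ v ∈ V₁, f v ∈ Y) ∧ ∀ v ∈ V₂, f v ∈ X) := by
  have hd := Set.disjoint_left.1 hXY
  have hcov : ∀ v, f v ∈ X ∨ f v ∈ Y := fun v => by
    obtain ⟨w, hw⟩ := hG.preconnected.exists_adj_of_nontrivial v
    rcases hf v w hw with h' | h' <;> tauto
  -- Whether `f` respects the sides at `v` does not change along an edge, so it is constant on the
  -- graph.
  have key := eq_of_connected hG.preconnected (fun v => (f v ∈ X ↔ v ∈ V₁)) (by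
    intro u v huv
    have h1 := hf u v huv
    have h2 := h.isBipartiteWith.mem_of_adj huv
    simp only [Finset.mem_coe] at h2
    have hu := h.not_mem (v := u)
    have hv := h.not_mem (v := v)
    have hu' := @hd (f u)
    have hv' := @hd (f v)
    exact propext (by tauto))
  obtain ⟨v₀⟩ := hG.nonempty
  by_cases h0 : f v₀ ∈ X ↔ v₀ ∈ V₁
  · have hall : ∀ v, f v ∈ X ↔ v ∈ V₁ := fun v => by
      have := key v₀ v
      exact this ▸ h0
    refine Or.inl ⟨fun v hv => (hall v).2 hv, fun v hv => (hcov v).resolve_left fun hx => ?_⟩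
    exact h.not_mem ((hall v).1 hx) hv
  · have hall : ∀ v, ¬ (f v ∈ X ↔ v ∈ V₁) := fun v => by
      have := key v₀ v
      exact this ▸ h0
    refine Or.inr ⟨fun v hv => (hcov v).resolve_left fun hx => hall v (by tauto), fun v hv => ?_⟩
    have := hall v
    have h3 := h.symm.not_mem hv
    tauto

end Generic

end SizeRamsey

namespace SizeRamsey

open SimpleGraph Finset

/-! ### Embedding trees into dense bipartite graphs -/

section Embedding

variable {W : Type*}

/-- A dense bipartite relation has a nonempty part in which all degrees are large. -/
lemma exists_large_degrees (K : W → W → Prop) [DecidableRel K] [DecidableEq W] (m n : ℕ) :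
    ∀ (s : ℕ) (A B : Finset W), A.card + B.card = s →
      A.card * n + B.card * m < ∑ x ∈ A, (B.filter fun y => K x y).card →
      ∃ A' B' : Finset W, A' ⊆ A ∧ B' ⊆ B ∧ A'.Nonempty ∧ B'.Nonempty ∧
        (∀ x ∈ A', n ≤ (B'.filter fun y => K x y).card) ∧
        ∀ y ∈ B', m ≤ (A'.filter fun x => K x y).card := by
  intro s
  induction s with
  | zero =>
    intro A B hs h
    have : A = ∅ := by rw [← Finset.card_eq_zero]; omega
    simp [this] at h
  | succ s ih =>
    intro A B hs h
    -- Deleting a vertex of too small degree lowers the left side of the inequality by more than the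
    -- edge count, so the strict inequality survives and the process stops before a part is empty.
    by_cases hA : ∀ x ∈ A, n ≤ (B.filter fun y => K x y).card
    · by_cases hB : ∀ y ∈ B, m ≤ (A.filter fun x => K x y).card
      · refine ⟨A, B, subset_rfl, subset_rfl, ?_, ?_, hA, hB⟩
        · rw [Finset.nonempty_iff_ne_empty]
          rintro rfl
          simp at h
        · rw [Finset.nonempty_iff_ne_empty]
          rintro rfl
          simp at h
      · push Not at hB
        obtain ⟨y, hy, hym⟩ := hB
        have hc := Finset.card_erase_add_one hy
        have hsum : ∑ x ∈ A, (B.filter fun y => K x y).card =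
            ∑ x ∈ A, ((B.erase y).filter fun y => K x y).card
              + (A.filter fun x => K x y).card := by
          rw [Finset.card_filter (fun x => K x y), ← Finset.sum_add_distrib]
          refine Finset.sum_congr rfl fun x _ => ?_
          rw [Finset.card_filter, Finset.card_filter, Finset.sum_erase_add _ _ hy]
        obtain ⟨A', B', h1, h2, h3⟩ := ih A (B.erase y) (by omega) (by
          rw [hsum, ← hc, add_mul] at h
          omega)
        exact ⟨A', B', h1, h2.trans (Finset.erase_subset _ _), h3⟩
    · push Not at hA
      obtain ⟨x, hx, hxn⟩ := hA
      have hc := Finset.card_erase_add_one hx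
      obtain ⟨A', B', h1, h2, h3⟩ := ih (A.erase x) B (by omega) (by
        rw [← Finset.sum_erase_add _ _ hx, ← hc, add_mul] at h
        omega)
      exact ⟨A', B', h1.trans (Finset.erase_subset _ _), h2, h3⟩

/-- Greedy embedding of a properly two-coloured tree into a bipartite graph with large degrees. -/
lemma exists_tree_embedding [DecidableEq W] (K : SimpleGraph W) [DecidableRel K.Adj]
    (A : Bool → Finset W) (hdisj : Disjoint (A true) (A false)) (N : Bool → ℕ)
    (hne : ∀ b, (A b).Nonempty)
    (hdeg : ∀ b, ∀ x ∈ A b, N (!b) ≤ ((A (!b)).filter fun y => K.Adj x y).card) :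
    ∀ (n : ℕ) (V : Type u) [Fintype V] (T : SimpleGraph V) (σ : V → Bool), T.IsTree →
      Fintype.card V = n → (∀ u v, T.Adj u v → σ v = !σ u) →
      (∀ b, (univ.filter fun v => σ v = b).card ≤ N b) →
      ∃ f : V → W, Function.Injective f ∧ (∀ v, f v ∈ A (σ v)) ∧
        ∀ u v, T.Adj u v → K.Adj (f u) (f v) := by
  classical
  intro n
  induction n with
  | zero =>
    intro V _ T σ hT hn
    have := hT.connected.nonempty
    exact absurd hn Fintype.card_ne_zero
  | succ n ih =>
    intro V _ T σ hT hn hσ hN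
    rcases subsingleton_or_nontrivial V with hV | hV
    · choose w hw using hne
      exact ⟨fun v => w (σ v), Function.injective_of_subsingleton _, fun v => hw _,
        fun u v huv => absurd (Subsingleton.elim u v) huv.ne⟩
    · obtain ⟨l, hl⟩ := hT.exists_vert_degree_one_of_nontrivial
      obtain ⟨p, hlp, hp⟩ := degree_eq_one_iff_existsUnique_adj.1 hl
      have hT' : (T.induce {l}ᶜ).IsTree :=
        ⟨hT.connected.induce_compl_singleton_of_degree_eq_one hl, hT.isAcyclic.induce _⟩
      have hcount : ∀ b, (univ.filter fun v : ({l}ᶜ : Set V) => σ v = b).card ≤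
          ((univ.filter fun v => σ v = b).erase l).card := fun b =>
        Finset.card_le_card_of_injOn Subtype.val
          (fun v hv => by
            have h1 := v.2
            simp only [Set.mem_compl_iff, Set.mem_singleton_iff] at h1
            have h2 : σ v = b := by simpa using hv
            simp [h1, h2]) Subtype.val_injective.injOn
      obtain ⟨f, hf, hfA, hfK⟩ := ih ({l}ᶜ : Set V) (T.induce {l}ᶜ) (fun v => σ v) hT'
        (by
          rw [Fintype.card_compl_set]
          simp [hn]) (fun u v huv => hσ u v huv)
        (fun b => (hcount b).trans ((Finset.card_le_card (Finset.erase_subset _ _)).trans (hN b)))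
      have hpl : p ≠ l := hlp.ne'
      set p' : ({l}ᶜ : Set V) := ⟨p, hpl⟩ with hp'
      have hσl : σ l = !σ p := hσ p l hlp.symm
      -- As `A true` and `A false` are disjoint, only embedded vertices of the class of `l` can
      -- block a neighbour of `f p'`; leaving out `l` itself makes the inequality strict.
      have hlt : ((univ.filter fun v : ({l}ᶜ : Set V) => σ v = σ l).image f).card <
          ((A (!σ p)).filter fun y => K.Adj (f p') y).card := by
        refine lt_of_lt_of_le (lt_of_le_of_lt (Finset.card_image_le.trans (hcount (σ l))) ?_)
          (hdeg (σ p) (f p') (hfA p'))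
        refine lt_of_lt_of_le (Finset.card_erase_lt_of_mem (by simp)) ?_
        rw [← hσl]
        exact hN _
      obtain ⟨w, hw, hwn⟩ := Finset.exists_mem_notMem_of_card_lt_card hlt
      simp only [Finset.mem_filter] at hw
      have hAd : ∀ x, x ∈ A true → x ∉ A false := fun _ h => Finset.disjoint_left.1 hdisj h
      have hfw : ∀ v, f v ≠ w := by
        intro v hv
        have h1 := hfA v
        rw [hv] at h1
        by_cases hs : σ v = σ l
        · exact hwn (Finset.mem_image.2 ⟨v, by simp [hs], hv⟩)
        · have h2 := hw.1
          rw [← hσl] at h2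
          rcases hb : σ v with _ | _ <;> rcases hb' : σ l with _ | _ <;> rw [hb] at h1 hs <;>
            rw [hb'] at h2 hs <;> first | exact hs rfl | exact hAd w h1 h2 | exact hAd w h2 h1
      refine ⟨fun v => if h : v = l then w else f ⟨v, h⟩, ?_, ?_, ?_⟩
      · intro u v huv
        by_cases hu : u = l <;> by_cases hv : v = l
        · rw [hu, hv]
        · simp only [hu, hv, dif_pos, dif_neg, not_false_iff] at huv
          exact absurd huv.symm (hfw _)
        · simp only [hu, hv, dif_pos, dif_neg, not_false_iff] at huv
          exact absurd huv (hfw _)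
        · simp only [hu, hv, dif_neg, not_false_iff] at huv
          exact congrArg Subtype.val (hf huv)
      · intro v
        by_cases hv : v = l
        · subst hv
          simpa [hσl] using hw.1
        · simpa [hv] using hfA ⟨v, hv⟩
      · intro u v huv
        by_cases hu : u = l <;> by_cases hv : v = l
        · exact absurd (hu.trans hv.symm) huv.ne
        · subst hu
          obtain rfl : v = p := hp v huv
          simpa [hv] using hw.2.symm
        · subst hv
          obtain rfl : u = p := hp u huv.symm
          simpa [hu] using hw.2
        · simp only [hu, hv, dif_neg, not_false_iff]
          exact hfK ⟨u, hu⟩ ⟨v, hv⟩ huv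

end Embedding

/-! ### The biclique as an arrowing graph -/

section UpperBound

variable {V : Type u} [Fintype V] {T : SimpleGraph V}

/-- The complete bipartite graph with parts `{0, …, a - 1}` and `{a, …, a + b - 1}`. -/
def biclique (a b : ℕ) : SimpleGraph (Fin (a + b)) where
  Adj u v := (u.val < a ∧ a ≤ v.val) ∨ (v.val < a ∧ a ≤ u.val)
  symm := ⟨fun _ _ h => h.symm⟩
  loopless := ⟨fun _ h => by omega⟩

lemma card_fin_lt (a b : ℕ) : (univ.filter fun u : Fin (a + b) => u.val < a).card = a := by
  rw [Fin.card_filter_val_lt]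
  omega

lemma card_fin_ge (a b : ℕ) : (univ.filter fun u : Fin (a + b) => a ≤ u.val).card = b := by
  have h := Finset.card_filter_add_card_filter_not (s := (univ : Finset (Fin (a + b))))
    (fun u : Fin (a + b) => u.val < a)
  simp only [card_fin_lt, not_lt, Finset.card_univ, Fintype.card_fin] at h
  omega

lemma biclique_edges_le (a b : ℕ) : (biclique a b).edgeSet.ncard ≤ a * b := by
  classical
  have hsub : (biclique a b).edgeSet ⊆
      (((univ.filter fun u : Fin (a + b) => u.val < a) ×ˢ
        (univ.filter fun u : Fin (a + b) => a ≤ u.val)).image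
          fun q => s(q.1, q.2) : Finset (Sym2 (Fin (a + b)))) := by
    intro e he
    induction e using Sym2.inductionOn with
    | hf u v =>
      rw [SimpleGraph.mem_edgeSet] at he
      simp only [Finset.coe_image, Set.mem_image, Finset.mem_coe, Finset.mem_product,
        Finset.mem_filter, Finset.mem_univ, true_and]
      rcases he with h | h
      · exact ⟨(u, v), h, rfl⟩
      · exact ⟨(v, u), h, Sym2.eq_swap⟩
  refine (Set.ncard_le_ncard hsub (Finset.finite_toSet _)).trans ?_
  rw [Set.ncard_coe_finset]
  refine Finset.card_image_le.trans ?_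
  rw [Finset.card_product, card_fin_lt, card_fin_ge]

/-- The biclique with parts of size `4 r |V₁|`, `4 r |V₂|` arrows `T` in `r` colours. -/
lemma biclique_arrows (hT : T.IsTree) {V₁ V₂ : Finset V} (hV : IsBipartition T V₁ V₂)
    (h₁ : V₁.Nonempty) (h₂ : V₂.Nonempty) {r a b : ℕ} (hr : 0 < r)
    (ha : a = 4 * r * V₁.card) (hb : b = 4 * r * V₂.card) :
    Arrows r (biclique a b) T := by
  classical
  intro χ
  have h1 := h₁.card_pos
  have h2 := h₂.card_pos
  set A : Finset (Fin (a + b)) := univ.filter fun u => u.val < a with hA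
  set B : Finset (Fin (a + b)) := univ.filter fun u => a ≤ u.val with hB
  have hsum : ∑ k : Fin r, ∑ x ∈ A, (B.filter fun y => (χ.labelGraph k).Adj x y).card
      = a * b := by
    rw [Finset.sum_comm]
    have : ∀ x ∈ A, ∑ k : Fin r, (B.filter fun y => (χ.labelGraph k).Adj x y).card = b := by
      intro x hx
      have hx' : x.val < a := by simpa [hA] using hx
      have hBc : B.card = b := card_fin_ge a b
      refine Eq.trans ?_ hBc
      simp_rw [Finset.card_filter]
      rw [Finset.sum_comm, Finset.card_eq_sum_ones]
      refine Finset.sum_congr rfl fun y hy => ?_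
      have hy' : a ≤ y.val := by simpa [hB] using hy
      have hadj : (biclique a b).Adj x y := Or.inl ⟨hx', hy'⟩
      have : ∀ k, (χ.labelGraph k).Adj x y ↔ χ ⟨s(x, y), hadj⟩ = k := fun k => by
        rw [EdgeLabeling.labelGraph_adj]
        exact ⟨fun ⟨_, h⟩ => h, fun h => ⟨hadj, h⟩⟩
      simp [this]
    rw [Finset.sum_congr rfl this, Finset.sum_const, card_fin_lt, smul_eq_mul]
  -- Otherwise the colour classes together have at most 8r²|V₁||V₂| edges, half of what the biclique
  -- has.
  have hex : ∃ k : Fin r, A.card * V₂.card + B.card * V₁.card <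
      ∑ x ∈ A, (B.filter fun y => (χ.labelGraph k).Adj x y).card := by
    by_contra! hcon
    have := Finset.sum_le_sum fun k (_ : k ∈ (univ : Finset (Fin r))) => hcon k
    rw [hsum, Finset.sum_const, card_fin_lt, card_fin_ge, Finset.card_univ, Fintype.card_fin,
      smul_eq_mul, ha, hb] at this
    have hpos : 0 < r * r * (V₁.card * V₂.card) := by positivity
    nlinarith
  obtain ⟨k, hk⟩ := hex
  refine ⟨k, ?_⟩
  obtain ⟨A', B', hA', hB', hAne, hBne, hdA, hdB⟩ :=
    exists_large_degrees (χ.labelGraph k).Adj V₁.card V₂.card _ A B rfl hk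
  obtain ⟨f, hf, -, hfK⟩ := exists_tree_embedding (χ.labelGraph k)
    (fun b => if b then A' else B')
    (by
      simp only [if_true, Bool.false_eq_true, if_false]
      refine Finset.disjoint_of_subset_left hA' (Finset.disjoint_of_subset_right hB' ?_)
      rw [Finset.disjoint_left]
      intro x hx hx'
      simp only [hA, hB, Finset.mem_filter] at hx hx'
      omega)
    (fun b => if b then V₁.card else V₂.card)
    (by rintro (_ | _) <;> simpa)
    (by
      rintro (_ | _)
      · intro y hy
        simp only [Bool.false_eq_true, if_false, Bool.not_false, if_true] at hy ⊢
        simpa only [SimpleGraph.adj_comm] using hdB y hy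
      · intro x hx
        simpa using hdA x (by simpa using hx))
    _ V T (fun v => decide (v ∈ V₁)) hT rfl
    (fun u v huv => by
      have h3 := hV.isBipartiteWith.mem_of_adj huv
      simp only [Finset.mem_coe] at h3
      have := hV.not_mem (v := u)
      have := hV.not_mem (v := v)
      by_cases hu : u ∈ V₁ <;> by_cases hv : v ∈ V₁ <;> simp [hu, hv] <;> tauto)
    (by
      rintro (_ | _)
      · simp only [decide_eq_false_iff_not, Bool.false_eq_true, if_false]
        refine Finset.card_le_card fun v hv => ?_
        exact (hV.cover v).resolve_left (by simpa using hv)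
      · simp)
  exact ⟨⟨⟨f, fun {u v} huv => hfK u v huv⟩, hf⟩⟩

end UpperBound

end SizeRamsey

namespace SizeRamsey

open SimpleGraph Finset

/-! ### Non-stars, radius two and fullness -/

section Trees

variable {V : Type*} {T : SimpleGraph V}

lemma nontrivial_of_not_isStar (hT : T.Connected) (hs : ¬ IsStar T) : Nontrivial V := by
  by_contra h
  rw [not_nontrivial_iff_subsingleton] at h
  obtain ⟨c⟩ := hT.nonempty
  exact hs ⟨c, Subsingleton.elim _ _⟩

/-- If `V₁` were a single vertex, every other vertex would have it as its only neighbour. -/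
lemma IsBipartition.two_le_card (hT : T.Connected) (hs : ¬ IsStar T) {V₁ V₂ : Finset V}
    (h : IsBipartition T V₁ V₂) : 2 ≤ V₁.card := by
  have := nontrivial_of_not_isStar hT hs
  by_contra! hlt
  obtain ⟨v₀⟩ := hT.nonempty
  obtain ⟨c, hc⟩ : ∃ c, c ∈ V₁ := by
    rcases h.cover v₀ with hv | hv
    · exact ⟨_, hv⟩
    · obtain ⟨w, hw⟩ := hT.preconnected.exists_adj_of_nontrivial v₀
      exact ⟨w, h.symm.mem_right hw hv⟩
  have huniq : ∀ v ∈ V₁, v = c := fun v hv =>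
    Finset.card_le_one.1 (by omega) v hv c hc
  have hadj : ∀ v, v ≠ c → T.Adj c v := fun v hv => by
    obtain ⟨w, hw⟩ := hT.preconnected.exists_adj_of_nontrivial v
    have hv2 := (h.cover v).resolve_left fun h1 => hv (huniq v h1)
    rw [← huniq w (h.symm.mem_right hw hv2)]
    exact hw.symm
  refine hs ⟨c, ?_⟩
  ext x y
  rw [starGraph_adj]
  refine ⟨fun hxy => ⟨hxy.ne, ?_⟩, ?_⟩
  · rcases h.isBipartiteWith.mem_of_adj hxy with h' | h'
    · exact Or.inl (huniq _ h'.1)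
    · exact Or.inr (huniq _ h'.2)
  · rintro ⟨hne, rfl | rfl⟩
    · exact hadj _ hne.symm
    · exact (hadj _ hne).symm

lemma not_isStar_of_radius_eq_two (hT : T.Connected) (hr : T.radius = 2) : ¬ IsStar T := by
  rintro ⟨c, rfl⟩
  have h1 : (starGraph c).eccent c ≤ 1 :=
    (eccent_le_one_iff c).2 fun v hv => starGraph_center_adj hv
  have h2 := radius_le_eccent.trans h1
  rw [hr] at h2
  exact absurd h2 (by decide)

variable [Fintype V] [DecidableRel T.Adj]

lemma degree_le_maxDegreeOn {S : Finset V} {v : V} (hv : v ∈ S) :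
    T.degree v ≤ maxDegreeOn T S :=
  Finset.le_sup (f := fun v => T.degree v) hv

lemma exists_degree_eq_maxDegreeOn {S : Finset V} (hS : S.Nonempty) :
    ∃ v ∈ S, T.degree v = maxDegreeOn T S := by
  obtain ⟨v, hv, h⟩ := Finset.exists_mem_eq_sup S hS fun v => T.degree v
  exact ⟨v, hv, h.symm⟩

/-- If the degrees in `V₁` were at most 1, the closed neighbourhood of a vertex of `V₂` would be a
whole component, yet `V₂` has a second vertex. -/
lemma IsBipartition.two_le_maxDegreeOn (hT : T.Connected) (hs : ¬ IsStar T)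
    {V₁ V₂ : Finset V} (h : IsBipartition T V₁ V₂) : 2 ≤ maxDegreeOn T V₁ := by
  by_contra! hlt
  have hdeg : ∀ u ∈ V₁, ∀ v w, T.Adj u v → T.Adj u w → v = w := by
    intro u hu v w hv hw
    have := degree_le_maxDegreeOn (T := T) hu
    rw [← card_neighborFinset_eq_degree] at this
    exact Finset.card_le_one.1 (show (T.neighborFinset u).card ≤ 1 by omega) v (by simpa using hv) w (by simpa using hw)
  have h2 := h.symm.two_le_card hT hs
  obtain ⟨p, hp, q, hq, hpq⟩ := Finset.one_lt_card.1 (show 1 < V₂.card by omega)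
  have key := eq_of_connected hT.preconnected (fun v => (v = p ∨ T.Adj p v)) (by
    have step : ∀ u v, u ∈ V₁ → T.Adj u v → ((u = p ∨ T.Adj p u) ↔ (v = p ∨ T.Adj p v)) := by
      intro u v hu huv
      have hv := h.mem_right huv hu
      constructor
      · rintro (rfl | h1)
        · exact absurd hp (h.not_mem hu)
        · exact Or.inl (hdeg u hu _ _ huv h1.symm)
      · rintro (rfl | h1)
        · exact Or.inr huv.symm
        · exact absurd (h.symm.mem_right h1 hp) (h.symm.not_mem hv)
    intro u v huv
    rcases h.isBipartiteWith.mem_of_adj huv with h' | h'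
    · exact propext (step u v h'.1 huv)
    · exact propext (step v u h'.2 huv.symm).symm) p q
  have : q = p ∨ T.Adj p q := key ▸ Or.inl rfl
  rcases this with h1 | h1
  · exact hpq h1.symm
  · exact h.not_mem (h.symm.mem_right h1 hp) hq

/-- A centre has distance at most 2 to the opposite part, and this distance is odd, hence 1. -/
lemma exists_full_vertex_of_radius_eq_two (hT : T.Connected) (hr : T.radius = 2)
    {V₁ V₂ : Finset V} (h : IsBipartition T V₁ V₂) :
    ∃ u, (u ∈ V₁ → V₂.card ≤ T.degree u) ∧ (u ∈ V₂ → V₁.card ≤ T.degree u) := by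
  have := hT.nonempty
  obtain ⟨u, hu⟩ := T.exists_eccent_eq_radius
  refine ⟨u, ?_⟩
  have key : ∀ {A B : Finset V}, IsBipartition T A B → u ∈ A → B.card ≤ T.degree u := by
    intro A B hAB huA
    rw [← card_neighborFinset_eq_degree]
    refine Finset.card_le_card fun v hv => ?_
    rw [mem_neighborFinset]
    have h2 : T.edist u v ≤ 2 := by
      rw [← hr, ← hu]
      exact edist_le_eccent
    obtain ⟨w, hw⟩ := (hT u v).exists_walk_length_eq_edist
    rw [← hw] at h2
    have h3 : w.length ≤ 2 := by exact_mod_cast h2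
    match w, h3 with
    | .nil, _ => exact absurd hv (hAB.not_mem huA)
    | .cons h1 .nil, _ => exact h1
    | .cons h1 (.cons h2 .nil), _ =>
      exact absurd (hAB.symm.mem_right h2 (hAB.mem_right h1 huA)) (hAB.symm.not_mem hv)
  exact ⟨key h, key h.symm⟩

lemma isFull_one_of_radius_eq_two (hT : T.Connected) (hr : T.radius = 2)
    {V₁ V₂ : Finset V} (h : IsBipartition T V₁ V₂) : IsFull T 1 V₁ V₂ := by
  obtain ⟨u, hu⟩ := exists_full_vertex_of_radius_eq_two hT hr h
  simp only [IsFull, one_mul, Nat.cast_le]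
  exact (h.cover u).imp (fun h1 => (hu.1 h1).trans (degree_le_maxDegreeOn h1))
    fun h1 => (hu.2 h1).trans (degree_le_maxDegreeOn h1)

lemma isFull_of_le_maxDegree [Nonempty V] {α : ℝ} (hα : 0 < α)
    (hd : α * (Fintype.card V : ℝ) ≤ (T.maxDegree : ℝ)) {V₁ V₂ : Finset V}
    (h : IsBipartition T V₁ V₂) : IsFull T α V₁ V₂ := by
  obtain ⟨v, hv⟩ := T.exists_maximal_degree_vertex
  rw [hv] at hd
  have key : ∀ {A B : Finset V}, v ∈ A → α * (B.card : ℝ) ≤ (maxDegreeOn T A : ℝ) := by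
    intro A B hA
    have h1 : (B.card : ℝ) ≤ Fintype.card V := by exact_mod_cast Finset.card_le_univ B
    have h2 : (T.degree v : ℝ) ≤ maxDegreeOn T A := by exact_mod_cast degree_le_maxDegreeOn hA
    exact ((mul_le_mul_of_nonneg_left h1 hα.le).trans hd).trans h2
  exact (h.cover v).imp key key

end Trees

/-! ### The upper bound for full trees -/

section UpperBound

variable {V : Type u} [Fintype V] {T : SimpleGraph V}

lemma exists_arrowingSizes_le (hT : T.IsTree) (hs : ¬ IsStar T) {V₁ V₂ : Finset V}
    (hV : IsBipartition T V₁ V₂) {r : ℕ} (hr : 0 < r) :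
    ∃ m ∈ arrowingSizes r T, m ≤ 16 * r ^ 2 * (V₁.card * V₂.card) := by
  have h1 := hV.two_le_card hT.connected hs
  have h2 := hV.symm.two_le_card hT.connected hs
  refine ⟨_, ⟨_, biclique (4 * r * V₁.card) (4 * r * V₂.card), biclique_arrows hT hV
    (Finset.card_pos.1 (by omega)) (Finset.card_pos.1 (by omega)) hr rfl rfl, rfl⟩,
    (biclique_edges_le _ _).trans (le_of_eq (by ring))⟩

variable [DecidableRel T.Adj]

/-- One of the two summands of `beta` already suffices. This is the only use of fullness. -/
lemma mul_card_le_beta {α : ℝ} {V₁ V₂ : Finset V} (h : IsFull T α V₁ V₂) :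
    α * ((V₁.card : ℝ) * V₂.card) ≤ beta T V₁ V₂ := by
  simp only [beta, Nat.cast_add, Nat.cast_mul]
  have e1 : (0 : ℝ) ≤ V₁.card := by positivity
  have e2 : (0 : ℝ) ≤ V₂.card := by positivity
  have e3 : (0 : ℝ) ≤ maxDegreeOn T V₁ := by positivity
  have e4 : (0 : ℝ) ≤ maxDegreeOn T V₂ := by positivity
  rcases h with h | h
  · have := mul_le_mul_of_nonneg_left h e1
    have := mul_nonneg e2 e4
    linarith
  · have := mul_le_mul_of_nonneg_left h e2
    have := mul_nonneg e1 e3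
    linarith

lemma sizeRamsey_le_of_isFull (hT : T.IsTree) (hs : ¬ IsStar T) {V₁ V₂ : Finset V}
    (hV : IsBipartition T V₁ V₂) {r : ℕ} (hr : 0 < r) {α : ℝ} (hα : 0 < α)
    (h : IsFull T α V₁ V₂) :
    (sizeRamsey r T : ℝ) ≤ 16 / α * (r : ℝ) ^ 2 * (beta T V₁ V₂ : ℝ) := by
  obtain ⟨m, hm, hle⟩ := exists_arrowingSizes_le hT hs hV hr
  have h1 : (sizeRamsey r T : ℝ) ≤ 16 * (r : ℝ) ^ 2 * ((V₁.card : ℝ) * V₂.card) := by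
    exact_mod_cast (Nat.sInf_le hm).trans hle
  refine h1.trans ?_
  have h2 := mul_le_mul_of_nonneg_left (mul_card_le_beta h)
    (show 0 ≤ 16 / α * (r : ℝ) ^ 2 by positivity)
  refine le_trans (le_of_eq ?_) h2
  field_simp

end UpperBound

end SizeRamsey

namespace SizeRamsey

open SimpleGraph Finset

/-! ### Colourings for the individual groups of edges -/

section Colorings

variable {V W : Type*}

/-- The edges of a graph of small maximum degree can be coloured so that every vertex has at most
`s` edges of each colour. -/
lemma exists_bounded_edge_coloring [DecidableEq W] {D s k : ℕ} (hs : 2 * D < k * s)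
    (E : Finset (Sym2 W)) (hE : ∀ v, (E.filter fun e => v ∈ e).card ≤ D) :
    ∃ χ : Sym2 W → Fin k, ∀ v j, (E.filter fun e => v ∈ e ∧ χ e = j).card ≤ s := by
  have hk : 0 < k := Nat.pos_of_ne_zero (by rintro rfl; simp at hs)
  induction E using Finset.induction_on with
  | empty => exact ⟨fun _ => ⟨0, hk⟩, by simp⟩
  | insert e E he ih =>
    obtain ⟨χ, hχ⟩ := ih fun v => (Finset.card_le_card
      (Finset.filter_subset_filter _ (Finset.subset_insert _ _))).trans (hE v)
    -- At most `D / s` colours are saturated at each end of `e`, so `2 * D < k * s` leaves a free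
    -- one.
    have hsat : ∀ v, (univ.filter fun j =>
        s ≤ (E.filter fun e => v ∈ e ∧ χ e = j).card).card * s ≤ D := by
      intro v
      calc _ ≤ ∑ j ∈ univ.filter fun j => s ≤ (E.filter fun e => v ∈ e ∧ χ e = j).card,
              (E.filter fun e => v ∈ e ∧ χ e = j).card := by
            rw [← smul_eq_mul]
            exact Finset.card_nsmul_le_sum _ _ _ fun j hj => (Finset.mem_filter.1 hj).2
        _ ≤ ∑ j, (E.filter fun e => v ∈ e ∧ χ e = j).card :=
            Finset.sum_le_sum_of_subset (Finset.subset_univ _)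
        _ = (E.filter fun e => v ∈ e).card := by
            rw [Finset.card_eq_sum_card_fiberwise (f := χ) (t := univ) (by simp)]
            simp_rw [Finset.filter_filter]
        _ ≤ D := (Finset.card_le_card
            (Finset.filter_subset_filter _ (Finset.subset_insert _ _))).trans (hE v)
    obtain ⟨j, hj⟩ : ∃ j, ∀ v ∈ e, (E.filter fun e => v ∈ e ∧ χ e = j).card < s := by
      induction e using Sym2.inductionOn with
      | hf u w =>
        by_contra! hcon
        have hcov : (univ : Finset (Fin k)) ⊆
            (univ.filter fun j => s ≤ (E.filter fun e => u ∈ e ∧ χ e = j).card) ∪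
            (univ.filter fun j => s ≤ (E.filter fun e => w ∈ e ∧ χ e = j).card) := by
          intro j _
          obtain ⟨v, hv, hvs⟩ := hcon j
          rcases Sym2.mem_iff.1 hv with rfl | rfl
          · exact Finset.mem_union_left _ (by simpa using hvs)
          · exact Finset.mem_union_right _ (by simpa using hvs)
        have h1 := (Finset.card_le_card hcov).trans (Finset.card_union_le _ _)
        rw [Finset.card_univ, Fintype.card_fin] at h1
        have h2 := Nat.mul_le_mul_right s h1
        rw [add_mul] at h2
        have := hsat u
        have := hsat w
        omega
    refine ⟨Function.update χ e j, fun v i => ?_⟩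
    have hEq : (E.filter fun e' => v ∈ e' ∧ Function.update χ e j e' = i) =
        E.filter fun e' => v ∈ e' ∧ χ e' = i := by
      refine Finset.filter_congr fun e' he' => ?_
      rw [Function.update_of_ne (ne_of_mem_of_not_mem he' he)]
    rw [Finset.filter_insert, hEq]
    split_ifs with h
    · refine (Finset.card_insert_le _ _).trans ?_
      have h3 : j = i := by simpa using h.2
      exact h3 ▸ hj v h.1
    · exact hχ v i

lemma avoids_of_degree_le [Fintype V] [Fintype W] {G : SimpleGraph W} [DecidableRel G.Adj]
    {H : SimpleGraph V} [DecidableRel H.Adj] {D s k : ℕ} (hs : 2 * D < k * s)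
    (hG : ∀ v, G.degree v ≤ D) (hH : ∃ v, s < H.degree v) : Avoids k G H := by
  classical
  obtain ⟨χ, hχ⟩ := exists_bounded_edge_coloring hs G.edgeFinset fun v => by
    rw [← incidenceFinset_eq_filter, card_incidenceFinset_eq_degree]
    exact hG v
  obtain ⟨v, hv⟩ := hH
  refine ⟨fun x y => χ s(x, y), fun x y _ => ⟨by simp only [Sym2.eq_swap], Fin.is_lt _⟩,
    fun j f hf h => ?_⟩
  have hcol : ∀ w, H.Adj v w → G.Adj (f v) (f w) ∧ (χ s(f v, f w)).val = j := fun w hw => h v w hw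
  obtain ⟨w₀, hw₀⟩ : (H.neighborFinset v).Nonempty := by
    rw [← Finset.card_pos, card_neighborFinset_eq_degree]
    omega
  have hw₀' := hcol w₀ (by simpa using hw₀)
  have h1 : (H.neighborFinset v).card ≤
      (G.edgeFinset.filter fun e => f v ∈ e ∧ χ e = χ s(f v, f w₀)).card := by
    refine Finset.card_le_card_of_injOn (fun w => s(f v, f w)) (fun w hw => ?_) ?_
    · have := hcol w (by simpa using hw)
      simp only [Finset.coe_filter, Set.mem_ofPred_eq, mem_edgeFinset, mem_edgeSet]
      exact ⟨this.1, Sym2.mem_mk_left _ _, Fin.ext (this.2.trans hw₀'.2.symm)⟩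
    · intro a _ b _ hab
      exact hf (Sym2.congr_right.1 hab)
  rw [card_neighborFinset_eq_degree] at h1
  have := hχ (f v) (χ s(f v, f w₀))
  omega

/-- Colouring by slopes in the affine plane over `ZMod p`: the monochromatic components are
contained in the preimages of lines. -/
lemma avoids_slopes [Fintype V] {G : SimpleGraph W} {H : SimpleGraph V} [Nontrivial V]
    (hH : H.Connected) {p b : ℕ} [Fact p.Prime] (X : Finset W)
    (hX : ∀ u v, G.Adj u v → u ∈ X) (φ : W → ZMod p × ZMod p)
    (hφ : ∀ t, (X.filter fun x => φ x = t).card ≤ b) (hV : p * b < Fintype.card V) :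
    Avoids (p + 1) G H := by
  classical
  obtain ⟨v₀⟩ := hH.nonempty
  have hne : ∃ u v, H.Adj u v := ⟨v₀, hH.preconnected.exists_adj_of_nontrivial v₀⟩
  -- The value of `ψ` names a line of a parallel class, and `ι z` parametrises line `z` by one
  -- coordinate. A connected monochromatic copy lies over one line, hence has at most `p * b`
  -- vertices.
  have hline : ∀ (ψ : ZMod p × ZMod p → ZMod p) (ι : ZMod p → ZMod p → ZMod p × ZMod p),
      (∀ t, t = ι (ψ t) t.1 ∨ t = ι (ψ t) t.2) →
      ∀ f : V → W, Function.Injective f → (∀ v, f v ∈ X) →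
      (∀ u v, H.Adj u v → ψ (φ (f u)) = ψ (φ (f v))) → False := by
    intro ψ ι hι f hf hfX hψ
    have hc := eq_of_connected hH.preconnected (fun v => ψ (φ (f v))) hψ
    set z := ψ (φ (f v₀)) with hz
    have h1 : Fintype.card V ≤ (X.filter fun x => ψ (φ x) = z).card := by
      rw [← Finset.card_univ]
      exact Finset.card_le_card_of_injOn f (fun v _ => by simp [hfX v, hz, hc v v₀]) hf.injOn
    have h2 : (X.filter fun x => ψ (φ x) = z) ⊆
        univ.biUnion fun t : ZMod p => X.filter fun x => φ x = ι z t := by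
      intro x hx
      simp only [Finset.mem_filter] at hx
      simp only [Finset.mem_biUnion, Finset.mem_univ, true_and, Finset.mem_filter]
      rcases hι (φ x) with h | h <;> rw [hx.2] at h
      · exact ⟨_, hx.1, h⟩
      · exact ⟨_, hx.1, h⟩
    have h3 := (Finset.card_le_card h2).trans
      (Finset.card_biUnion_le_card_mul _ _ b fun t _ => hφ _)
    rw [Finset.card_univ, ZMod.card] at h3
    omega
  -- `none` is the vertical slope; it also takes the edges whose ends lie over the same point.
  refine avoids_of_coloring (κ := Option (ZMod p))
    (fun u v => if (φ u).1 = (φ v).1 then none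
      else some (((φ u).2 - (φ v).2) / ((φ u).1 - (φ v).1))) (by simp [ZMod.card]) ?_ ?_ hne
  · intro u v _
    by_cases h : (φ u).1 = (φ v).1
    · simp [h]
    · simp only [h, Ne.symm h, if_false, Option.some.injEq]
      rw [← neg_sub (φ v).2, ← neg_sub (φ v).1, neg_div_neg_eq]
  · intro j f hf h
    have hfX : ∀ v, f v ∈ X := fun v => by
      obtain ⟨w, hw⟩ := hH.preconnected.exists_adj_of_nontrivial v
      exact hX _ _ (h v w hw).1
    cases j with
    | none =>
      refine hline (fun t => t.1) (fun z t => (z, t)) (fun t => Or.inr rfl) f hf hfX ?_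
      intro u v huv
      by_contra hne'
      simpa [hne'] using (h u v huv).2
    | some m =>
      refine hline (fun t => t.2 - m * t.1) (fun z t => (t, z + m * t))
        (fun t => Or.inl (by ext <;> simp)) f hf hfX ?_
      intro u v huv
      have h2 := (h u v huv).2
      by_cases h1 : (φ (f u)).1 = (φ (f v)).1
      · simp [h1] at h2
      · simp only [h1, if_false, Option.some.injEq] at h2
        rw [div_eq_iff (sub_ne_zero.2 h1)] at h2
        linear_combination h2

/-- A finite set can be divided into `m` blocks of size at most `q` if it has at most `q * m`
elements. -/
lemma exists_block_map (X : Finset W) {q m : ℕ} (hm : 0 < m) (hX : X.card ≤ q * m) :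
    ∃ φ : W → Fin m, ∀ j, (X.filter fun x => φ x = j).card ≤ q := by
  classical
  rcases Nat.eq_zero_or_pos q with rfl | hq
  · have : X = ∅ := by rw [← Finset.card_eq_zero]; omega
    exact ⟨fun _ => ⟨0, hm⟩, by simp [this]⟩
  · let e := X.equivFin
    let g : W → ℕ := fun x => if h : x ∈ X then (e ⟨x, h⟩).val else 0
    have hg : ∀ x, g x < q * m := fun x => by
      by_cases h : x ∈ X
      · simp only [g, h, dif_pos]
        exact (Fin.is_lt _).trans_le hX
      · simp only [g, h, dif_neg, not_false_iff]
        positivity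
    have hginj : ∀ x ∈ X, ∀ y ∈ X, g x = g y → x = y := fun x hx y hy h => by
      simp only [g, hx, hy, dif_pos] at h
      exact congrArg Subtype.val (e.injective (Fin.ext h))
    refine ⟨fun x => ⟨g x / q, Nat.div_lt_of_lt_mul (hg x)⟩, fun j => ?_⟩
    have := Finset.card_le_card_of_injOn (s := X.filter fun x =>
      (⟨g x / q, Nat.div_lt_of_lt_mul (hg x)⟩ : Fin m) = j) (t := Finset.range q)
      (fun x => g x % q) (fun x _ => by simpa using Nat.mod_lt _ hq) (by
        intro x hx y hy hxy
        simp only [Finset.coe_filter, Set.mem_ofPred_eq] at hx hy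
        refine hginj x hx.1 y hy.1 ?_
        have h1 : g x / q = g y / q := congrArg Fin.val (hx.2.trans hy.2.symm)
        have h2 : g x % q = g y % q := hxy
        rw [← Nat.div_add_mod (g x) q, h1, h2, Nat.div_add_mod])
    simpa using this

/-- A colouring of the edges between `X` and `Y` without monochromatic copy of `H`: no colour
class has room for `V₁` in `X`, nor in `Y`. -/
lemma avoids_of_bipartite {κ : Type*} [Fintype κ] [Fintype V] [Nontrivial V]
    {G : SimpleGraph W} {H : SimpleGraph V} [DecidableRel H.Adj] (hH : H.Connected)
    {V₁ V₂ : Finset V} (hV : IsBipartition H V₁ V₂) {X Y : Finset W} (hXY : Disjoint X Y)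
    (hG : ∀ u v, G.Adj u v → (u ∈ X ∧ v ∈ Y) ∨ (u ∈ Y ∧ v ∈ X)) (c : W → W → κ)
    (hX : ∀ j, ∃ Z : Finset W, Z.card < V₁.card ∧
      ∀ x ∈ X, ∀ y ∈ Y, G.Adj x y → c x y = j → x ∈ Z)
    (hY : Y.card < V₁.card ∨ ∃ v ∈ V₁, ∀ y ∈ Y, ∀ j, ∃ Z : Finset W, Z.card < H.degree v ∧
      ∀ x ∈ X, G.Adj x y → c x y = j → x ∈ Z) :
    Avoids (Fintype.card κ) G H := by
  classical
  have hd := Finset.disjoint_left.1 hXY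
  obtain ⟨v₀⟩ := hH.nonempty
  refine avoids_of_coloring (fun u v => if u ∈ X then c u v else c v u) le_rfl ?_ ?_
    ⟨v₀, hH.preconnected.exists_adj_of_nontrivial v₀⟩
  · intro u v huv
    rcases hG u v huv with h | h
    · have : v ∉ X := fun hx => hd hx h.2
      simp [h.1, this]
    · have : u ∉ X := fun hx => hd hx h.1
      simp [h.2, this]
  · intro j f hf h
    rcases hV.sides hH f (Finset.disjoint_coe.2 hXY) (fun u v huv => hG _ _ (h u v huv).1)
      with ⟨h1, h2⟩ | ⟨h1, h2⟩
    · obtain ⟨Z, hZ, hZ'⟩ := hX j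
      have : V₁.card ≤ Z.card := by
        refine Finset.card_le_card_of_injOn f (fun v hv => ?_) hf.injOn
        obtain ⟨w, hw⟩ := hH.preconnected.exists_adj_of_nontrivial v
        obtain ⟨h3, h4⟩ := h v w hw
        have hvX : f v ∈ X := h1 v hv
        rw [if_pos hvX] at h4
        exact hZ' _ hvX _ (h2 w (hV.mem_right hw hv)) h3 h4
      omega
    · rcases hY with hY | ⟨v, hv, hY⟩
      · have : V₁.card ≤ Y.card :=
          Finset.card_le_card_of_injOn f (fun v hv => h1 v hv) hf.injOn
        omega
      · obtain ⟨Z, hZ, hZ'⟩ := hY (f v) (h1 v hv) j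
        have : (H.neighborFinset v).card ≤ Z.card := by
          refine Finset.card_le_card_of_injOn f (fun w hw => ?_) hf.injOn
          have hw' : H.Adj v w := by simpa using hw
          obtain ⟨h3, h4⟩ := h v w hw'
          have hvX : f v ∉ X := fun hx => hd hx (h1 v hv)
          rw [if_neg hvX] at h4
          exact hZ' _ (h2 w (hV.mem_right hw' hv)) h3.symm h4
        rw [card_neighborFinset_eq_degree] at this
        omega

/-- Colour an edge by the block of its end in `X`: `V₁` fits neither into a block nor into `Y`. -/
lemma avoids_of_small_part [Fintype V] [Nontrivial V]
    {G : SimpleGraph W} {H : SimpleGraph V} (hH : H.Connected)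
    {V₁ V₂ : Finset V} (hV : IsBipartition H V₁ V₂) {X Y : Finset W} (hXY : Disjoint X Y)
    (hG : ∀ u v, G.Adj u v → (u ∈ X ∧ v ∈ Y) ∨ (u ∈ Y ∧ v ∈ X)) {q m : ℕ} (hm : 0 < m)
    (hX : X.card ≤ q * m) (hq : q < V₁.card) (hY : Y.card < V₁.card) : Avoids m G H := by
  classical
  obtain ⟨φ, hφ⟩ := exists_block_map X hm hX
  have := avoids_of_bipartite (κ := Fin m) hH hV hXY hG (fun x _ => φ x)
    (fun j => ⟨X.filter fun x => φ x = j, (hφ j).trans_lt hq,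
      fun x hx y _ _ h => by simp [hx, h]⟩) (Or.inl hY)
  rwa [Fintype.card_fin] at this

/-- If every `x ∈ X` has three labels, and every `y ∈ Y` can select one label of each neighbour
`x ∈ X` so that no label is selected too often, the edges between `X` and `Y` can be coloured
without monochromatic copy of `H`. -/
lemma avoids_of_labels [Fintype V] [Nontrivial V] {G : SimpleGraph W} {H : SimpleGraph V}
    [DecidableRel H.Adj] (hH : H.Connected) {V₁ V₂ : Finset V} (hV : IsBipartition H V₁ V₂)
    {X Y : Finset W} (hXY : Disjoint X Y)
    (hG : ∀ u v, G.Adj u v → (u ∈ X ∧ v ∈ Y) ∨ (u ∈ Y ∧ v ∈ X)) {q k : ℕ} (hq0 : 0 < q)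
    (hq : q < V₁.card) (S : W → Fin 3 → Fin k) (a : W → W → Fin 3) {v : V} (hv : v ∈ V₁)
    (ha : ∀ y ∈ Y, ∀ i, ∃ Z : Finset W, Z.card < H.degree v ∧
      ∀ x ∈ X, G.Adj x y → S x (a y x) = i → x ∈ Z) :
    Avoids (k + 3 * X.card / q) G H := by
  classical
  let P : Fin k → Finset W := fun i => X.filter fun x => ∃ l, S x l = i
  have hsum : ∑ i, (P i).card ≤ 3 * X.card := by
    simp only [P, Finset.card_filter]
    rw [Finset.sum_comm, mul_comm, ← smul_eq_mul]
    refine Finset.sum_le_card_nsmul _ _ _ fun x _ => ?_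
    rw [← Finset.card_filter]
    calc _ ≤ (univ.image (S x)).card := Finset.card_le_card fun i hi => by simpa using hi
      _ ≤ 3 := Finset.card_image_le.trans (by simp)
  have hblock : ∀ i, ∃ φ : W → Fin ((P i).card / q + 1),
      ∀ j, ((P i).filter fun x => φ x = j).card ≤ q := fun i =>
    exists_block_map _ (Nat.succ_pos _) (by
      have := Nat.lt_div_mul_add (a := (P i).card) hq0
      rw [mul_comm q, add_mul, one_mul]
      exact this.le)
  choose φ hφ using hblock
  -- A colour is a label together with a block of its class. Every `x` lies in at most three
  -- classes, so rounding up costs one extra block per label, `k` in all.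
  have key := avoids_of_bipartite (κ := Σ i : Fin k, Fin ((P i).card / q + 1)) hH hV hXY hG
    (fun x y => ⟨S x (a y x), φ (S x (a y x)) x⟩)
    (fun j => ⟨(P j.1).filter fun x => φ j.1 x = j.2, (hφ _ _).trans_lt hq, by
      rintro x hx y - - rfl
      simp only [P, Finset.mem_filter]
      exact ⟨⟨hx, _, rfl⟩, trivial⟩⟩)
    (Or.inr ⟨v, hv, fun y hy j => by
      obtain ⟨Z, hZ, hZ'⟩ := ha y hy j.1
      exact ⟨Z, hZ, fun x hx hxy h => hZ' x hx hxy (congrArg Sigma.fst h)⟩⟩)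
  refine key.mono ?_ le_rfl
  simp only [Fintype.card_sigma, Fintype.card_fin]
  rw [Finset.sum_add_distrib, Finset.sum_const, Finset.card_univ, Fintype.card_fin, smul_eq_mul,
    mul_one, add_comm]
  refine Nat.add_le_add_left ?_ _
  rw [Nat.le_div_iff_mul_le hq0, Finset.sum_mul]
  exact (Finset.sum_le_sum fun i _ => Nat.div_mul_le_self _ _).trans hsum

end Colorings

end SizeRamsey

namespace SizeRamsey

open Finset

/-! ### Random labels -/

section RandomLabels

variable {W : Type*} [DecidableEq W] {k : ℕ}

/-- The elements of `N` can select labels so that no label is selected more than `s` times. -/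
def Selectable (s : ℕ) (N : Finset W) (S : W → Fin 3 → Fin k) : Prop :=
  ∃ a : W → Fin 3, ∀ i, (N.filter fun x => S x (a x) = i).card ≤ s

/-- Hall's theorem with `s` copies of every label. -/
lemma selectable_of_hall {s : ℕ} {N : Finset W} {S : W → Fin 3 → Fin k}
    (h : ∀ A ⊆ N, A.card ≤ s * (A.biUnion fun x => univ.image (S x)).card) :
    Selectable s N S := by
  classical
  let t : N → Finset (Fin k × Fin s) := fun x => univ.image (S x) ×ˢ univ
  have hall : ∀ A : Finset N, A.card ≤ (A.biUnion t).card := by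
    intro A
    have h1 := h (A.map (Function.Embedding.subtype _)) (fun x hx => by
      obtain ⟨y, -, rfl⟩ := Finset.mem_map.1 hx
      exact y.2)
    rw [Finset.card_map] at h1
    have h2 : A.biUnion t = ((A.map (Function.Embedding.subtype _)).biUnion
        fun x => univ.image (S x)) ×ˢ (univ : Finset (Fin s)) := by
      ext ⟨i, j⟩
      simp [t]
    rw [h2, Finset.card_product, Finset.card_univ, Fintype.card_fin, mul_comm]
    exact h1
  obtain ⟨f, hf, hft⟩ := (Finset.all_card_le_biUnion_card_iff_exists_injective t).1 hall
  have hl : ∀ x : N, ∃ l, S x l = (f x).1 := fun x => by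
    have := (Finset.mem_product.1 (hft x)).1
    simpa using this
  choose l hl using hl
  refine ⟨fun x => if hx : x ∈ N then l ⟨x, hx⟩ else 0, fun i => ?_⟩
  have hfi : ∀ x (hx : x ∈ N), S x (if hx : x ∈ N then l ⟨x, hx⟩ else 0) = (f ⟨x, hx⟩).1 :=
    fun x hx => by rw [dif_pos hx]; exact hl ⟨x, hx⟩
  rcases Nat.eq_zero_or_pos s with rfl | hs
  · have : N = ∅ := by
      rw [← Finset.card_eq_zero]
      have := h N subset_rfl
      omega
    simp [this]
  · refine (Finset.card_le_card_of_injOn (t := (univ : Finset (Fin s)))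
      (fun x => if hx : x ∈ N then (f ⟨x, hx⟩).2 else ⟨0, hs⟩) (fun _ _ => by simp) ?_).trans
      (by simp)
    intro x hx y hy hxy
    simp only [Finset.coe_filter, Set.mem_ofPred_eq] at hx hy
    simp only [hx.1, hy.1, dif_pos] at hxy
    have h1 := (hfi x hx.1).symm.trans (hx.2.trans (hy.2.symm.trans (hfi y hy.1)))
    exact congrArg Subtype.val (hf (Prod.ext h1 hxy))

variable [Fintype W]

lemma card_labels_mem (A : Finset W) (U : Finset (Fin k)) :
    (univ.filter fun S : W → Fin 3 → Fin k => ∀ x ∈ A, ∀ l, S x l ∈ U).card =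
      (U.card ^ 3) ^ A.card * (k ^ 3) ^ (Fintype.card W - A.card) := by
  have h : (univ.filter fun S : W → Fin 3 → Fin k => ∀ x ∈ A, ∀ l, S x l ∈ U) =
      Fintype.piFinset fun x => if x ∈ A then Fintype.piFinset fun _ : Fin 3 => U else univ := by
    ext S
    simp only [Finset.mem_filter, Finset.mem_univ, true_and, Fintype.mem_piFinset]
    refine forall_congr' fun x => ?_
    by_cases hx : x ∈ A <;> simp [hx]
  rw [h, Fintype.card_piFinset]
  have h2 : ∀ x, (if x ∈ A then Fintype.piFinset fun _ : Fin 3 => U else univ).card =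
      if x ∈ A then U.card ^ 3 else k ^ 3 := fun x => by
    by_cases hx : x ∈ A <;> simp [hx, Fintype.card_piFinset]
  simp_rw [h2]
  rw [Finset.prod_ite, Finset.prod_const, Finset.prod_const]
  congr 2
  · simp
  · rw [Finset.filter_not, Finset.card_sdiff_of_subset (Finset.filter_subset _ _)]
    simp

lemma choose_le_three_mul_div_pow (n j : ℕ) (hj : 0 < j) :
    (n.choose j : ℝ) ≤ (3 * n / j) ^ j := by
  have hj' : (0 : ℝ) < j := by exact_mod_cast hj
  have h1 : (n.choose j : ℝ) ≤ (n : ℝ) ^ j / j.factorial := Nat.choose_le_pow_div j n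
  have h2 : (j : ℝ) ^ j / j.factorial ≤ 3 ^ j := by
    refine (Real.pow_div_factorial_le_exp _ hj'.le j).trans ?_
    rw [← Real.exp_one_pow]
    have := Real.exp_one_lt_d9
    exact pow_le_pow_left₀ (Real.exp_pos _).le (by linarith) _
  refine h1.trans ?_
  rw [div_pow, mul_pow, le_div_iff₀ (by positivity)]
  calc (n : ℝ) ^ j / j.factorial * j ^ j = j ^ j / j.factorial * n ^ j := by ring
    _ ≤ _ := by gcongr

/-- Put x = u/k with u = ⌊(j-1)/s⌋. Each of the two binomials costs at most a constant times x⁻¹ per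
element; three labels give x³ per element. The spare factor x^j supplies 1/k², and the constant 128
makes the terms summable over j. -/
lemma union_bound_term_le {N k s j : ℕ} (hs : 0 < s) (hk : 0 < k) (hN : 128 * N ≤ k * s)
    (hj : s < j) (hjN : j ≤ N) :
    (N.choose j : ℝ) * (k.choose ((j - 1) / s)) * (((j - 1) / s : ℕ) / k : ℝ) ^ (3 * j) ≤
      (1 / 2) ^ j / 2 / k ^ 2 := by
  set u := (j - 1) / s with hu
  have hu1 : 1 ≤ u := (Nat.one_le_div_iff hs).2 (by omega)
  have hus : u * s ≤ j - 1 := Nat.div_mul_le_self _ _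
  have huj : u ≤ j := (Nat.div_le_self _ _).trans (Nat.sub_le _ _)
  have huk : u ≤ k := by
    have : u * s ≤ k * s := by omega
    exact Nat.le_of_mul_le_mul_right this hs
  have hu' : (0 : ℝ) < u := by exact_mod_cast hu1
  have hk' : (0 : ℝ) < k := by exact_mod_cast hk
  have hs' : (0 : ℝ) < s := by exact_mod_cast hs
  have hj' : (0 : ℝ) < j := by exact_mod_cast (by omega : 0 < j)
  have hx1 : (u : ℝ) / k ≤ 1 := by
    rw [div_le_one hk']
    exact_mod_cast huk
  have hx0 : 0 < (u : ℝ) / k := by positivity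
  set x : ℝ := u / k with hx
  have c1 : (N.choose j : ℝ) ≤ (3 / 128 * x⁻¹) ^ j := by
    refine (choose_le_three_mul_div_pow N j (by omega)).trans ?_
    refine pow_le_pow_left₀ (by positivity) ?_ _
    rw [hx, inv_div, div_le_iff₀ hj']
    have h1 : (128 * N : ℝ) ≤ k * s := by exact_mod_cast hN
    have h2 : (u * s : ℝ) ≤ j := by exact_mod_cast hus.trans (Nat.sub_le _ _)
    have h3 : (k : ℝ) * s ≤ k / u * j := by
      rw [div_mul_eq_mul_div, le_div_iff₀ hu']
      nlinarith
    linarith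
  have c2 : (k.choose u : ℝ) ≤ (3 * x⁻¹) ^ j := by
    refine (choose_le_three_mul_div_pow k u hu1).trans ?_
    rw [hx, inv_div, mul_div_assoc]
    refine pow_le_pow_right₀ ?_ huj
    have : (1 : ℝ) ≤ k / u := by
      rw [le_div_iff₀ hu']
      simpa using (by exact_mod_cast huk : (u : ℝ) ≤ k)
    linarith
  have hj4 : (j : ℝ) ^ 2 ≤ 4 ^ j := by
    have h1 : (j : ℝ) ≤ 2 ^ j := by exact_mod_cast (Nat.lt_two_pow_self (n := j)).le
    calc (j : ℝ) ^ 2 ≤ (2 ^ j) ^ 2 := by gcongr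
      _ = 4 ^ j := by rw [← pow_mul, mul_comm, pow_mul]; norm_num
  have hxj : x ^ j ≤ 4 ^ j / k ^ 2 := by
    calc x ^ j ≤ x ^ 2 := pow_le_pow_of_le_one hx0.le hx1 (by omega)
      _ = u ^ 2 / k ^ 2 := by rw [hx, div_pow]
      _ ≤ j ^ 2 / k ^ 2 := by gcongr
      _ ≤ _ := by gcongr
  calc (N.choose j : ℝ) * (k.choose u) * x ^ (3 * j)
      ≤ (3 / 128 * x⁻¹) ^ j * (3 * x⁻¹) ^ j * x ^ (3 * j) := by gcongr
    _ = (9 / 128) ^ j * x ^ j := by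
        rw [pow_mul, ← mul_pow, ← mul_pow, ← mul_pow]
        congr 1
        field_simp
        norm_num
    _ ≤ (9 / 128) ^ j * (4 ^ j / k ^ 2) := by gcongr
    _ = (9 / 32) ^ j / k ^ 2 := by
        rw [← mul_div_assoc, ← mul_pow]
        norm_num
    _ ≤ (1 / 2) ^ j / 2 / k ^ 2 := by
        gcongr
        obtain ⟨i, rfl⟩ : ∃ i, j = i + 1 + 1 := ⟨j - 2, by omega⟩
        have : ((9 : ℝ) / 32) ^ i ≤ (1 / 2) ^ i :=
          pow_le_pow_left₀ (by norm_num) (by norm_num) _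
        have h0 : (0 : ℝ) ≤ (1 / 2) ^ i := by positivity
        simp only [pow_succ]
        linarith

/-- With random labels, the probability that `N` cannot select labels is at most `1 / k ^ 2`. -/
lemma card_not_selectable_mul_le {s : ℕ} (hs : 0 < s) (hk : 0 < k) {N : Finset W}
    (hN : 128 * N.card ≤ k * s) [DecidablePred fun S : W → Fin 3 → Fin k => ¬ Selectable s N S] :
    (univ.filter fun S : W → Fin 3 → Fin k => ¬ Selectable s N S).card * k ^ 2 ≤
      Fintype.card (W → Fin 3 → Fin k) := by
  classical
  set n := Fintype.card W with hn
  -- The largest number of labels with which `j` elements can violate Hall's condition.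
  let u : ℕ → ℕ := fun j => (j - 1) / s
  let g : ℕ → ℕ := fun j => if s < j then
    k.choose (u j) * ((u j ^ 3) ^ j * (k ^ 3) ^ (n - j)) else 0
  have hsub : (univ.filter fun S : W → Fin 3 → Fin k => ¬ Selectable s N S) ⊆
      (N.powerset.filter fun A => s < A.card).biUnion fun A =>
        ((univ : Finset (Fin k)).powersetCard (u A.card)).biUnion fun U =>
          univ.filter fun S : W → Fin 3 → Fin k => ∀ x ∈ A, ∀ l, S x l ∈ U := by
    intro S hS
    have hS' : ¬ Selectable s N S := by simpa using hS
    obtain ⟨A, hAN, hA⟩ : ∃ A ⊆ N, s * (A.biUnion fun x => univ.image (S x)).card < A.card := by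
      by_contra! hcon
      exact hS' (selectable_of_hall hcon)
    set L := A.biUnion fun x => univ.image (S x) with hL
    have hLpos : 0 < L.card := by
      rw [Finset.card_pos]
      obtain ⟨x, hx⟩ : A.Nonempty := Finset.card_pos.1 (by omega)
      exact ⟨S x 0, Finset.mem_biUnion.2 ⟨x, hx, Finset.mem_image_of_mem _ (Finset.mem_univ _)⟩⟩
    have hsA : s < A.card := lt_of_le_of_lt (Nat.le_mul_of_pos_right s hLpos) hA
    have hLu : L.card ≤ u A.card := by
      rw [Nat.le_div_iff_mul_le hs, mul_comm]
      omega
    have huk : u A.card ≤ (univ : Finset (Fin k)).card := by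
      rw [Finset.card_univ, Fintype.card_fin]
      refine Nat.div_le_of_le_mul ?_
      have := Finset.card_le_card hAN
      rw [mul_comm s]
      omega
    obtain ⟨U, hLU, -, hU⟩ := Finset.exists_subsuperset_card_eq (Finset.subset_univ L) hLu huk
    simp only [Finset.mem_biUnion, Finset.mem_filter, Finset.mem_powerset,
      Finset.mem_powersetCard, Finset.mem_univ, true_and]
    exact ⟨A, ⟨hAN, hsA⟩, U, ⟨Finset.subset_univ _, hU⟩, fun x hx l => hLU
      (Finset.mem_biUnion.2 ⟨x, hx, Finset.mem_image_of_mem _ (Finset.mem_univ _)⟩)⟩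
  have h1 : (univ.filter fun S : W → Fin 3 → Fin k => ¬ Selectable s N S).card ≤
      ∑ j ∈ range (N.card + 1), N.card.choose j * g j := by
    calc _ ≤ ∑ A ∈ N.powerset.filter fun A => s < A.card, g A.card := by
          refine ((Finset.card_le_card hsub).trans Finset.card_biUnion_le).trans
            (Finset.sum_le_sum fun A hA => ?_)
          have hA' := (Finset.mem_filter.1 hA).2
          simp only [g, if_pos hA']
          refine Finset.card_biUnion_le.trans ?_
          rw [Finset.sum_congr rfl (g := fun _ =>
            (u A.card ^ 3) ^ A.card * (k ^ 3) ^ (n - A.card)) fun U hU => by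
              rw [card_labels_mem, (Finset.mem_powersetCard.1 hU).2]]
          rw [Finset.sum_const, Finset.card_powersetCard, Finset.card_univ, Fintype.card_fin,
            smul_eq_mul]
      _ ≤ ∑ A ∈ N.powerset, g A.card := Finset.sum_le_sum_of_subset (Finset.filter_subset _ _)
      _ = _ := by
          rw [Finset.sum_powerset_apply_card]
          simp only [smul_eq_mul]
  have hNn : N.card ≤ n := Finset.card_le_univ N
  have hk' : (0 : ℝ) < k := by exact_mod_cast hk
  have h2 : ∀ j ∈ range (N.card + 1), ((N.card.choose j * g j : ℕ) : ℝ) ≤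
      (1 / 2) ^ j / 2 / k ^ 2 * (k ^ 3 : ℝ) ^ n := by
    intro j hj
    rw [Finset.mem_range] at hj
    by_cases hsj : s < j
    · simp only [g, if_pos hsj]
      have hpow : (k ^ 3 : ℝ) ^ n = (k ^ 3 : ℝ) ^ (n - j) * (k ^ 3 : ℝ) ^ j := by
        rw [← pow_add]
        congr 1
        omega
      have := union_bound_term_le hs hk hN hsj (by omega)
      calc ((N.card.choose j * (k.choose (u j) * ((u j ^ 3) ^ j * (k ^ 3) ^ (n - j))) : ℕ) : ℝ)
          = (N.card.choose j : ℝ) * (k.choose (u j)) * ((u j : ℕ) / k : ℝ) ^ (3 * j)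
              * (k ^ 3 : ℝ) ^ n := by
            rw [hpow, pow_mul, div_pow, div_pow]
            push_cast
            field_simp
        _ ≤ _ := by gcongr
    · simp only [g, if_neg hsj, mul_zero, Nat.cast_zero]
      positivity
  have h3 : ((univ.filter fun S : W → Fin 3 → Fin k => ¬ Selectable s N S).card : ℝ) ≤
      1 / k ^ 2 * (k ^ 3 : ℝ) ^ n := by
    calc _ ≤ ((∑ j ∈ range (N.card + 1), N.card.choose j * g j : ℕ) : ℝ) := by exact_mod_cast h1
      _ ≤ ∑ j ∈ range (N.card + 1), (1 / 2 : ℝ) ^ j / 2 / k ^ 2 * (k ^ 3 : ℝ) ^ n := by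
          rw [Nat.cast_sum]
          exact Finset.sum_le_sum h2
      _ = (∑ j ∈ range (N.card + 1), (1 / 2 : ℝ) ^ j) / 2 / k ^ 2 * (k ^ 3 : ℝ) ^ n := by
          rw [← Finset.sum_mul, ← Finset.sum_div, ← Finset.sum_div]
      _ ≤ 2 / 2 / k ^ 2 * (k ^ 3 : ℝ) ^ n := by
          gcongr
          exact sum_geometric_two_le _
      _ = _ := by norm_num
  have hcard : (Fintype.card (W → Fin 3 → Fin k) : ℝ) = (k ^ 3 : ℝ) ^ n := by
    simp [hn]
  rw [← hcard, div_mul_eq_mul_div, one_mul, le_div_iff₀ (by positivity)] at h3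
  exact_mod_cast h3

/-- There are labels for which only a few of the sets `N y` cannot select labels. -/
lemma exists_labels {s : ℕ} (hs : 0 < s) (hk : 0 < k) (N : W → Finset W) (Y : Finset W)
    (hN : ∀ y ∈ Y, 128 * (N y).card ≤ k * s) :
    ∃ S : W → Fin 3 → Fin k, ∃ B ⊆ Y, (∀ y ∈ Y, y ∉ B → Selectable s (N y) S) ∧
      B.card * k ^ 2 ≤ (Y.filter fun y => s < (N y).card).card := by
  classical
  have : Nonempty (Fin k) := ⟨⟨0, hk⟩⟩
  -- A set of at most `s` elements is always selectable, so only large neighbourhoods enter the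
  -- average over `S`.
  set Y' := Y.filter fun y => s < (N y).card with hY'
  have hsum : ∑ S : W → Fin 3 → Fin k,
      (Y'.filter fun y => ¬ Selectable s (N y) S).card * k ^ 2 ≤
        ∑ _S : W → Fin 3 → Fin k, Y'.card := by
    rw [← Finset.sum_mul, Finset.sum_const, Finset.card_univ, smul_eq_mul]
    simp_rw [Finset.card_filter]
    rw [Finset.sum_comm, Finset.sum_mul, mul_comm, ← smul_eq_mul]
    refine Finset.sum_le_card_nsmul _ _ _ fun y hy => ?_
    rw [← Finset.card_filter]
    exact card_not_selectable_mul_le hs hk (hN y (Finset.mem_filter.1 hy).1)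
  obtain ⟨S, -, hS⟩ := Finset.exists_le_of_sum_le Finset.univ_nonempty hsum
  refine ⟨S, Y'.filter fun y => ¬ Selectable s (N y) S,
    (Finset.filter_subset _ _).trans (Finset.filter_subset _ _), fun y hy hyB => ?_, hS⟩
  by_cases h : s < (N y).card
  · by_contra hcon
    exact hyB (by simp [hY', hy, h, hcon])
  · exact ⟨fun _ => 0, fun i => (Finset.card_filter_le _ _).trans (not_lt.1 h)⟩

end RandomLabels

end SizeRamsey

namespace SizeRamsey

open SimpleGraph Finset

/-! ### Assembling the colouring, and the lower bound -/

section LowerBound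

variable {V W : Type*}

lemma le_sup_between (G : SimpleGraph W) {X Y B : Set W} (hXY : ∀ v, v ∈ X ∨ v ∈ Y) :
    G ≤ G.between Y Y ⊔ G.between X X ⊔ G.between X (Y \ B) ⊔ G.between X B := by
  intro u v huv
  simp only [SimpleGraph.sup_adj, SimpleGraph.between_adj, huv, true_and, Set.mem_sdiff]
  have := hXY u
  have := hXY v
  tauto

variable [Fintype W]

lemma card_filter_mul_le_twice_edges (G : SimpleGraph W) [DecidableRel G.Adj] (S : Finset W)
    {a : ℕ} (hS : ∀ v ∈ S, a ≤ G.degree v) : S.card * a ≤ 2 * G.edgeSet.ncard := by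
  classical
  rw [Set.ncard_eq_toFinset_card', ← SimpleGraph.edgeFinset, ← sum_degrees_eq_twice_card_edges,
    ← smul_eq_mul]
  exact (Finset.card_nsmul_le_sum _ _ _ hS).trans (Finset.sum_le_sum_of_subset (subset_univ _))

variable [Fintype V]

/-- A graph with few edges has a colouring without monochromatic copy of `T`. -/
lemma avoids_of_few_edges {T : SimpleGraph V} [DecidableRel T.Adj] (hT : T.Connected)
    (hs : ¬ IsStar T) {V₁ V₂ : Finset V} (hV : IsBipartition T V₁ V₂) (G : SimpleGraph W)
    {k : ℕ} (hk : 0 < k) (hkV : 8 * k ≤ Fintype.card V)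
    (hG : 65536 * G.edgeSet.ncard < k ^ 2 * (V₁.card * maxDegreeOn T V₁)) :
    Avoids (8 * k) G T := by
  classical
  have := nontrivial_of_not_isStar hT hs
  have hn₁ := hV.two_le_card hT hs
  have hd := hV.two_le_maxDegreeOn hT hs
  have hn : V₁.card ≤ Fintype.card V := Finset.card_le_univ V₁
  obtain ⟨v₁, hv₁, hdeg⟩ := exists_degree_eq_maxDegreeOn (T := T)
    (Finset.card_pos.1 (by omega : 0 < V₁.card))
  obtain ⟨s, hds⟩ : ∃ s, maxDegreeOn T V₁ = s + 1 := ⟨maxDegreeOn T V₁ - 1, by omega⟩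
  rw [hds] at hd hdeg hG
  set n₁ := V₁.card
  set m := G.edgeSet.ncard
  have hs0 : 0 < s := by omega
  set X : Finset W := univ.filter fun v => k * (s + 1) < 256 * G.degree v with hX
  set Y : Finset W := univ.filter fun v => 256 * G.degree v ≤ k * (s + 1) with hY
  have hXY : Disjoint X Y := by
    rw [Finset.disjoint_left]
    intro v h1 h2
    simp only [hX, hY, Finset.mem_filter] at h1 h2
    omega
  have hcov : ∀ v, v ∈ (X : Set W) ∨ v ∈ (Y : Set W) := fun v => by
    simpa [hX, hY] using lt_or_ge _ _
  have hks : 0 < k * s := Nat.mul_pos hk hs0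
  have hYdeg : ∀ y ∈ Y, 128 * G.degree y ≤ k * s := by
    intro y hy
    have h1 : 256 * G.degree y ≤ k * (s + 1) := by simpa [hY] using hy
    have h2 : k * (s + 1) ≤ 2 * (k * s) := by nlinarith
    omega
  -- Double counting: high-degree vertices are few because `G` has few edges.
  have hXcard : 128 * X.card < k * n₁ := by
    have h1 : X.card * (k * (s + 1)) ≤ 512 * m := by
      have := card_filter_mul_le_twice_edges G X (a := k * (s + 1) / 256 + 1) fun v hv => by
        have : k * (s + 1) < 256 * G.degree v := by simpa [hX] using hv
        omega
      have h2 : k * (s + 1) ≤ 256 * (k * (s + 1) / 256 + 1) := by omega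
      have h3 := Nat.mul_le_mul_left X.card h2
      rw [Nat.mul_left_comm X.card 256] at h3
      omega
    have h2 : (128 * X.card) * (k * (s + 1)) < (k * n₁) * (k * (s + 1)) := by
      calc (128 * X.card) * (k * (s + 1)) = 128 * (X.card * (k * (s + 1))) := by ring
        _ < k ^ 2 * (n₁ * (s + 1)) := by omega
        _ = _ := by ring
    exact lt_of_mul_lt_mul_right h2 (Nat.zero_le _)
  -- the four groups of edges
  have hYY : Avoids k (G.between Y Y) T := by
    refine avoids_of_degree_le (D := k * s / 128) (s := s) (by omega) (fun v => ?_)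
      ⟨v₁, by omega⟩
    by_cases hv : v ∈ Y
    · have h1 : (G.between (Y : Set W) Y).degree v ≤ G.degree v :=
        degree_le_of_le between_le
      have := hYdeg v hv
      omega
    · have : (G.between (Y : Set W) Y).degree v = 0 := by
        rw [← card_neighborFinset_eq_degree, Finset.card_eq_zero]
        ext w
        simp [between_adj, hv]
      omega
  -- Bertrand's postulate. A line carries at most p(|X|/p² + 1) vertices: |X|/p is small since `k <
  -- p`, and the rounding term p is at most a quarter of |V(T)| since `8 * k ≤ Fintype.card V`.
  obtain ⟨p, hp, hkp, hp2⟩ := Nat.exists_prime_lt_and_le_two_mul k hk.ne'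
  have := Fact.mk hp
  have hXX : Avoids (p + 1) (G.between X X) T := by
    have hpp : 0 < p * p := Nat.mul_pos hp.pos hp.pos
    have hq : X.card ≤ (X.card / (p * p) + 1) * (p * p) := by
      have := Nat.lt_div_mul_add (a := X.card) hpp
      rw [add_mul, one_mul]
      exact this.le
    obtain ⟨φ, hφ⟩ := exists_block_map X hpp hq
    let e : Fin (p * p) ≃ ZMod p × ZMod p := Fintype.equivOfCardEq (by simp [ZMod.card])
    refine avoids_slopes hT X (fun u v huv => ?_) (fun x => e (φ x))
      (b := X.card / (p * p) + 1) (fun t => ?_) ?_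
    · rcases (between_adj.1 huv).2 with h | h <;> exact h.1
    · simpa only [← Equiv.eq_symm_apply] using hφ (e.symm t)
    · refine lt_of_mul_lt_mul_left (a := p) ?_ (Nat.zero_le _)
      have h1 : X.card / (p * p) * (p * p) ≤ X.card := Nat.div_mul_le_self _ _
      have h2 : k * n₁ ≤ p * Fintype.card V := Nat.mul_le_mul hkp.le hn
      have h3 : p * (4 * p) ≤ p * Fintype.card V := Nat.mul_le_mul_left p (by omega)
      have h4 : p * (p * (X.card / (p * p) + 1)) = X.card / (p * p) * (p * p) + p * p := by ring
      have h5 : p * (4 * p) = 4 * (p * p) := by ring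
      omega
  have hNdeg : ∀ y, (X.filter fun x => G.Adj x y).card ≤ G.degree y := fun y => by
    rw [← card_neighborFinset_eq_degree]
    exact Finset.card_le_card fun x hx => by simpa using (Finset.mem_filter.1 hx).2.symm
  obtain ⟨S, B, hBY, hS, hB⟩ := exists_labels (k := k) hs0 hk
    (fun y => X.filter fun x => G.Adj x y) Y
    (fun y hy => (Nat.mul_le_mul_left _ (hNdeg y)).trans (hYdeg y hy))
  have hBcard : B.card < n₁ := by
    have h1 := card_filter_mul_le_twice_edges G
      (Y.filter fun y => s < (X.filter fun x => G.Adj x y).card) (a := s + 1)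
      fun y hy => lt_of_lt_of_le (Finset.mem_filter.1 hy).2 (hNdeg y)
    have h2 := (Nat.mul_le_mul_right (s + 1) hB).trans h1
    have h3 : B.card * (k ^ 2 * (s + 1)) < n₁ * (k ^ 2 * (s + 1)) := by
      calc B.card * (k ^ 2 * (s + 1)) = B.card * k ^ 2 * (s + 1) := by ring
        _ < k ^ 2 * (n₁ * (s + 1)) := by omega
        _ = _ := by ring
    exact lt_of_mul_lt_mul_right h3 (Nat.zero_le _)
  -- Blocks must have fewer than `n₁` vertices; `n₁ ≥ 2` makes `q` positive.
  obtain ⟨q, hq⟩ : ∃ q, n₁ = q + 1 := ⟨n₁ - 1, by omega⟩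
  have hXq : 3 * X.card ≤ q * k := by
    rw [hq] at hXcard hn₁
    have h1 : k * (q + 1) ≤ 2 * (q * k) := by nlinarith
    omega
  have hXB : Avoids k (G.between X B) T :=
    avoids_of_small_part hT hV (Finset.disjoint_of_subset_right hBY hXY)
      (fun u v huv => (between_adj.1 huv).2) (q := q) hk (by omega) (by omega) hBcard
  have hsel : ∀ y, ∃ a : W → Fin 3, y ∈ Y \ B → ∀ i,
      ((X.filter fun x => G.Adj x y).filter fun x => S x (a x) = i).card ≤ s := by
    intro y
    by_cases hy : y ∈ Y \ B
    · rw [Finset.mem_sdiff] at hy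
      obtain ⟨a, ha⟩ := hS y hy.1 hy.2
      exact ⟨a, fun _ => ha⟩
    · exact ⟨fun _ => 0, fun h => absurd h hy⟩
  choose a ha using hsel
  have hXG : Avoids (k + 3 * X.card / q) (G.between X (Y \ B : Finset W)) T :=
    avoids_of_labels hT hV (Finset.disjoint_of_subset_right Finset.sdiff_subset hXY)
      (fun u v huv => (between_adj.1 huv).2) (by omega) (by omega) S a hv₁
      (fun y hy i => ⟨_, by
        rw [hdeg]
        exact Nat.lt_succ_of_le (ha y hy i), fun x hx hxy h => by
        simp only [Finset.mem_filter]
        exact ⟨⟨hx, (between_adj.1 hxy).1⟩, h⟩⟩)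
  have hdiv : 3 * X.card / q ≤ k := Nat.div_le_of_le_mul hXq
  rw [Finset.coe_sdiff] at hXG
  -- The palettes have sizes k, p + 1 ≤ 2k + 1, at most 2k, and k.
  exact (((hYY.sup hXX).sup hXG).sup hXB).mono (by omega) (le_sup_between G hcov)

/-- The colouring is applied to either part as `V₁`, and the two bounds are added. From `16 ≤ r`
follows r ≤ 12⌊r/8⌋, and 2·144·65536 < 20000000. -/
lemma beta_le_of_arrows {T : SimpleGraph V} [DecidableRel T.Adj] (hT : T.Connected)
    (hs : ¬ IsStar T) {V₁ V₂ : Finset V} (hV : IsBipartition T V₁ V₂) {r : ℕ} (hr : 16 ≤ r)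
    (hrV : r ≤ Fintype.card V) {G : SimpleGraph W} (hG : Arrows r G T) :
    r ^ 2 * beta T V₁ V₂ ≤ 20000000 * G.edgeSet.ncard := by
  have key : ∀ {A B : Finset V}, IsBipartition T A B →
      (r / 8) ^ 2 * (A.card * maxDegreeOn T A) ≤ 65536 * G.edgeSet.ncard := by
    intro A B h
    by_contra! hcon
    exact ((avoids_of_few_edges hT hs h G (by omega) (by omega) hcon).mono
      (by omega) le_rfl).not_arrows hG
  have h1 := key hV
  have h2 := key hV.symm
  have h3 : r ^ 2 ≤ 144 * (r / 8) ^ 2 := by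
    calc r ^ 2 ≤ (12 * (r / 8)) ^ 2 := Nat.pow_le_pow_left (by omega) 2
      _ = _ := by ring
  have h4 := Nat.mul_le_mul_right (beta T V₁ V₂) h3
  have h5 : 144 * (r / 8) ^ 2 * beta T V₁ V₂ =
      144 * ((r / 8) ^ 2 * (V₁.card * maxDegreeOn T V₁) +
        (r / 8) ^ 2 * (V₂.card * maxDegreeOn T V₂)) := by
    unfold beta
    ring
  omega

lemma le_sizeRamsey {T : SimpleGraph V} [DecidableRel T.Adj] (hT : T.Connected)
    (hs : ¬ IsStar T) {V₁ V₂ : Finset V} (hV : IsBipartition T V₁ V₂) {r : ℕ} (hr : 16 ≤ r)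
    (hrV : r ≤ Fintype.card V) (hne : (arrowingSizes r T).Nonempty) :
    (1 / 20000000 : ℝ) * (r : ℝ) ^ 2 * (beta T V₁ V₂ : ℝ) ≤ (sizeRamsey r T : ℝ) := by
  -- Nonemptiness matters: the infimum of the empty set would be 0.
  obtain ⟨N, G, hG, hm⟩ := Nat.sInf_mem hne
  have h := beta_le_of_arrows hT hs hV hr hrV hG
  rw [hm] at h
  have h' : (r : ℝ) ^ 2 * (beta T V₁ V₂ : ℝ) ≤ 20000000 * (sizeRamsey r T : ℝ) := by
    exact_mod_cast h
  linarith

end LowerBound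

end SizeRamsey

theorem theorem4 :
    -- The order of magnitude, uniformly over all non-star `α`-full trees.
    (∃ (c : ℝ) (n₀ : ℕ → ℕ), 0 < c ∧ ∀ α : ℝ, 0 < α → α ≤ 1 → ∃ C : ℝ, 0 < C ∧
      ∀ r : ℕ, 16 ≤ r →
        ∀ (V : Type u) [Fintype V] (T : SimpleGraph V) [DecidableRel T.Adj],
          T.IsTree → ¬ SizeRamsey.IsStar T →
          ∀ V₁ V₂ : Finset V, SizeRamsey.IsBipartition T V₁ V₂ → SizeRamsey.IsFull T α V₁ V₂ →
            (SizeRamsey.arrowingSizes r T).Nonempty ∧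
            (n₀ r ≤ Fintype.card V →
              c * (r : ℝ) ^ 2 * (SizeRamsey.beta T V₁ V₂ : ℝ) ≤ (SizeRamsey.sizeRamsey r T : ℝ)) ∧
            (SizeRamsey.sizeRamsey r T : ℝ) ≤
              C * (r : ℝ) ^ 2 * (SizeRamsey.beta T V₁ V₂ : ℝ)) ∧
    -- Trees of radius `2` are not stars, and they are `1`-full.
    (∀ (V : Type u) [Fintype V] (T : SimpleGraph V) [DecidableRel T.Adj],
      T.IsTree → T.radius = 2 →
        ¬ SizeRamsey.IsStar T ∧
        ∀ V₁ V₂ : Finset V, SizeRamsey.IsBipartition T V₁ V₂ →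
          SizeRamsey.IsFull T 1 V₁ V₂) ∧
    -- Trees on `n` vertices with maximum degree at least `α n` are `α`-full.
    (∀ α : ℝ, 0 < α → α ≤ 1 →
      ∀ (V : Type u) [Fintype V] (T : SimpleGraph V) [DecidableRel T.Adj],
        T.IsTree → α * (Fintype.card V : ℝ) ≤ (T.maxDegree : ℝ) →
        ∀ V₁ V₂ : Finset V, SizeRamsey.IsBipartition T V₁ V₂ →
          SizeRamsey.IsFull T α V₁ V₂) := by
  -- The threshold is `n₀ r = r`, needed only for the slope colouring.
  refine ⟨⟨1 / 20000000, id, by norm_num, fun α hα _ => ⟨16 / α, by positivity, ?_⟩⟩,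
    fun V _ T _ hT hr => ⟨SizeRamsey.not_isStar_of_radius_eq_two hT.connected hr,
      fun V₁ V₂ hV => SizeRamsey.isFull_one_of_radius_eq_two hT.connected hr hV⟩,
    fun α hα _ V _ T _ hT hd V₁ V₂ hV => ?_⟩
  · intro r hr V _ T _ hT hs V₁ V₂ hV hfull
    obtain ⟨m, hm, -⟩ := SizeRamsey.exists_arrowingSizes_le hT hs hV (by omega : 0 < r)
    exact ⟨⟨m, hm⟩, fun hrV => SizeRamsey.le_sizeRamsey hT.connected hs hV hr hrV ⟨m, hm⟩,
      SizeRamsey.sizeRamsey_le_of_isFull hT hs hV (by omega) hα hfull⟩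
  · have := hT.connected.nonempty
    exact SizeRamsey.isFull_of_le_maxDegree hα hd hV
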